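/- Let $k \ge 2$ be an integer. Let $O_k$ be the odd graph: its vertices are the $(k-1)$-element subsets of $\{1,\dots,2k-1\}$, two of them being adjacent if and only if they are disjoint. Let $2O_k$ be its bipartite double: its vertices are the pairs $(v,j)$ with $v$ a vertex of $O_k$ and $j\in\{0,1\}$, and $(v,j)$ and $(w,l)$ are adjacent if and only if $v\cap w=\emptyset$ and $j\ne l$. Then the eigenvalues of (the adjacency matrix of) $2O_k$ are exactly the $2k$ integers $k-i$ and $-(k-i)$ with $0\le i\le k-1$. For each such $i$, both $k-i$ and $-(k-i)$ have multiplicity $\binom{2k-1}{i}-\binom{2k-1}{i-1}$, where $\binom{2k-1}{-1}=0$; here the multiplicity as a root of the characteristic polynomial and the dimension of the eigenspace coincide. -/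

import Mathlib

/-- The vertices of the odd graph `O_k`: the `(k - 1)`-subsets of a set with `2k - 1` elements. -/
abbrev OddVertex (k : ℕ) : Type := {v : Finset (Fin (2 * k - 1)) // v.card = k - 1}

/-- The odd graph `O_k` (meant for `k ≥ 2`): two `(k - 1)`-subsets of a `(2k - 1)`-set are adjacent
when they are disjoint. The condition `v ≠ w` follows from disjointness as soon as `k ≥ 2`. -/
def oddGraph (k : ℕ) : SimpleGraph (OddVertex k) where
  Adj v w := v ≠ w ∧ Disjoint v.1 w.1
  symm := ⟨fun _ _ h => ⟨h.1.symm, h.2.symm⟩⟩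
  loopless := ⟨fun _ h => h.1 rfl⟩

instance (k : ℕ) : DecidableRel (oddGraph k).Adj := fun v w =>
  inferInstanceAs (Decidable (v ≠ w ∧ Disjoint v.1 w.1))

/-- The graph `2O_k`, the bipartite double of the odd graph `O_k`: the vertices are two copies
`inl v`, `inr v` of each vertex `v` of `O_k`, and `inl v`, `inr w` are adjacent when `v`, `w` are
adjacent in `O_k`. -/
abbrev doubledOddGraph (k : ℕ) : SimpleGraph (OddVertex k ⊕ OddVertex k) :=
  (oddGraph k).bipartiteDoubleCover

/-! Let `A` be the adjacency matrix of `O_k`. That of `2O_k` has blocks `0, A, A, 0`, so its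
characteristic polynomial is that of `A * A` evaluated at `X ^ 2`. Complementing one argument turns
disjointness into inclusion, so `A * A = W * Wᵀ` for the inclusion matrix `W` of `(k-1)`-subsets in
`k`-subsets. The spectrum of `W_j * W_jᵀ` follows by induction on `j`:
`inclusionMatrix_succ_mul_transpose` makes the next product a scalar shift of `W_jᵀ * W_j`, which
has the same characteristic polynomial as `W_j * W_jᵀ` up to a power of `X`. That power is the one
new eigenvalue of each level. In the middle level the eigenvalues are the squares `(k-i)^2`. -/

open Polynomial in
/-- The characteristic polynomial of a bipartite block matrix with equal off-diagonal blocks. -/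
theorem charpoly_fromBlocks_zero_self {m R : Type*} [Fintype m] [DecidableEq m] [CommRing R]
    (A : Matrix m m R) :
    (Matrix.fromBlocks 0 A A 0).charpoly = (A * A).charpoly.comp (X ^ 2) := by
  have hcomp : (A * A).charpoly.comp (X ^ 2) =
      (Matrix.scalar m ((X : R[X]) ^ 2) - A.map C * A.map C).det := by
    have h := RingHom.map_det (Polynomial.compRingHom ((X : R[X]) ^ 2)) (A * A).charmatrix
    rw [Matrix.charpoly, ← Polynomial.coe_compRingHom_apply, h]
    congr 1
    ext1 i j
    by_cases hij : i = j
    · subst hij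
      simp [Matrix.charmatrix, ← Matrix.map_mul]
    · simp [Matrix.charmatrix, ← Matrix.map_mul, hij]
  have hchar : (Matrix.fromBlocks 0 A A 0).charmatrix =
      Matrix.fromBlocks (Matrix.scalar m (X : R[X])) (-A.map C) (-A.map C)
        (Matrix.scalar m (X : R[X])) := by
    rw [Matrix.charmatrix_fromBlocks]
    congr 1 <;> simp [Matrix.charmatrix]
  -- The right factor clears the lower left block; both determinants then contain `X ^ card m`,
  -- which is cancelled.
  have hmul : (Matrix.fromBlocks 0 A A 0).charmatrix *
      Matrix.fromBlocks (Matrix.scalar m (X : R[X])) 0 (A.map C) 1 =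
      Matrix.fromBlocks (Matrix.scalar m ((X : R[X]) ^ 2) - A.map C * A.map C) (-A.map C) 0
        (Matrix.scalar m (X : R[X])) := by
    rw [hchar, Matrix.fromBlocks_multiply]
    congr 1
    · rw [← map_mul, ← sq, Matrix.neg_mul, sub_eq_add_neg]
    · simp
    · rw [Matrix.neg_mul, (Matrix.scalar_commute X (fun r => Commute.all X r) (A.map C)).eq,
        neg_add_cancel]
    · simp
  have hdet := congrArg Matrix.det hmul
  rw [Matrix.det_mul, Matrix.det_fromBlocks_zero₁₂, Matrix.det_fromBlocks_zero₂₁,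
    Matrix.det_one, mul_one, ← hcomp] at hdet
  have hX : (Matrix.scalar m (X : R[X])).det = X ^ Fintype.card m := by simp
  rw [hX] at hdet
  exact (isRegular_X_pow _).right hdet

/-- For a real symmetric matrix the algebraic and geometric multiplicities agree. -/
theorem finrank_eigenspace_eq_rootMultiplicity_of_isSymm {m : Type*} [Fintype m] [DecidableEq m]
    {A : Matrix m m ℝ} (hA : A.IsSymm) (x : ℝ) :
    Module.finrank ℝ (Module.End.eigenspace (Matrix.toLin' A) x) =
      A.charpoly.rootMultiplicity x := by
  -- For symmetric `N`, `Nv ⬝ Nv = v ⬝ N(Nv)`, so `N(Nv) = 0` forces `Nv = 0`.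
  have hN : ∀ v, (Matrix.toLin' A - x • 1) ((Matrix.toLin' A - x • 1) v) = 0 →
      (Matrix.toLin' A - x • 1) v = 0 := by
    have hlin : Matrix.toLin' A - x • 1 = Matrix.toLin' (A - x • 1) := by
      simp [map_sub, Module.End.one_eq_id]
    intro v hv
    rw [hlin] at hv ⊢
    rw [Matrix.toLin'_apply] at hv ⊢
    rw [Matrix.toLin'_apply] at hv
    have hsymm : (A - x • 1).IsSymm := hA.sub (Matrix.isSymm_one.smul x)
    rw [← dotProduct_self_eq_zero]
    conv_lhs => rw [Matrix.dotProduct_mulVec, ← Matrix.mulVec_transpose, hsymm.eq, hv]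
    simp
  have hpow : ∀ (j : ℕ) (v), ((Matrix.toLin' A - x • 1) ^ j) v = 0 →
      (Matrix.toLin' A - x • 1) v = 0 := by
    intro j
    induction j with
    | zero => intro v hv; simp at hv; simp [hv]
    | succ j ih =>
      intro v hv
      rw [pow_succ] at hv
      exact hN v (ih _ hv)
  have heq : Module.End.eigenspace (Matrix.toLin' A) x =
      Module.End.maxGenEigenspace (Matrix.toLin' A) x := by
    ext v
    rw [Module.End.mem_maxGenEigenspace, Module.End.mem_eigenspace_iff]
    constructor
    · intro h
      exact ⟨1, by simp [h]⟩
    · rintro ⟨j, hj⟩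
      have := hpow j v hj
      simpa [sub_eq_zero] using this
  rw [heq, LinearMap.finrank_maxGenEigenspace_eq, Matrix.charpoly_toLin']

/-! ### Spectrum of the inclusion matrices of the Boolean lattice -/

/-- The incidence matrix, by inclusion, between `j`-subsets and `(j + 1)`-subsets. -/
def inclusionMatrix (α : Type*) [DecidableEq α] (j : ℕ) :
    Matrix {s : Finset α // s.card = j} {s : Finset α // s.card = j + 1} ℝ :=
  Matrix.of fun s t => if s.1 ⊆ t.1 then 1 else 0

section inclusionMatrix

variable {α : Type*} [Fintype α] [DecidableEq α]

theorem inclusionMatrix_mul_transpose_apply (j : ℕ) (s t : {s : Finset α // s.card = j}) :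
    (inclusionMatrix α j * (inclusionMatrix α j).transpose) s t =
      ((Finset.univ.filter fun u : Finset α => u.card = j + 1 ∧ s.1 ∪ t.1 ⊆ u).card : ℝ) := by
  have h : ∀ u : {s : Finset α // s.card = j + 1},
      inclusionMatrix α j s u * (inclusionMatrix α j).transpose u t =
        if s.1 ∪ t.1 ⊆ u.1 then 1 else 0 := by
    intro u
    simp only [inclusionMatrix, Matrix.transpose_apply, Matrix.of_apply, Finset.union_subset_iff]
    by_cases h1 : s.1 ⊆ u.1 <;> by_cases h2 : t.1 ⊆ u.1 <;> simp [h1, h2]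
  rw [Matrix.mul_apply, Finset.sum_congr rfl fun u _ => h u, ← Finset.filter_filter,
    Finset.card_filter, Nat.cast_sum,
    ← Finset.sum_subtype (Finset.univ.filter fun u : Finset α => u.card = j + 1) (by simp)
      (fun u => if s.1 ∪ t.1 ⊆ u then (1 : ℝ) else 0)]
  simp

theorem transpose_mul_inclusionMatrix_apply (j : ℕ) (s t : {s : Finset α // s.card = j + 1}) :
    ((inclusionMatrix α j).transpose * inclusionMatrix α j) s t =
      ((Finset.univ.filter fun u : Finset α => u.card = j ∧ u ⊆ s.1 ∩ t.1).card : ℝ) := by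
  have h : ∀ u : {s : Finset α // s.card = j},
      (inclusionMatrix α j).transpose s u * inclusionMatrix α j u t =
        if u.1 ⊆ s.1 ∩ t.1 then 1 else 0 := by
    intro u
    simp only [inclusionMatrix, Matrix.transpose_apply, Matrix.of_apply, Finset.subset_inter_iff]
    by_cases h1 : u.1 ⊆ s.1 <;> by_cases h2 : u.1 ⊆ t.1 <;> simp [h1, h2]
  rw [Matrix.mul_apply, Finset.sum_congr rfl fun u _ => h u, ← Finset.filter_filter,
    Finset.card_filter, Nat.cast_sum,
    ← Finset.sum_subtype (Finset.univ.filter fun u : Finset α => u.card = j) (by simp)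
      (fun u => if u ⊆ s.1 ∩ t.1 then (1 : ℝ) else 0)]
  simp

theorem card_filter_card_eq_succ_and_superset (s : Finset α) :
    (Finset.univ.filter fun u : Finset α => u.card = s.card + 1 ∧ s ⊆ u).card =
      Fintype.card α - s.card := by
  rw [← Finset.card_compl]
  symm
  refine Finset.card_bij (fun a _ => insert a s) ?_ ?_ ?_
  · intro a ha
    simp only [Finset.mem_compl] at ha
    simp [Finset.card_insert_of_notMem ha]
  · intro a ha b hb hab
    simp only [Finset.mem_compl] at ha hb
    have : a ∈ insert b s := hab ▸ Finset.mem_insert_self a s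
    simpa [ha] using this
  · intro u hu
    simp only [Finset.mem_filter, Finset.mem_univ, true_and] at hu
    obtain ⟨a, ha, hau⟩ := (Finset.covBy_iff_card_sdiff_eq_one.mpr ⟨hu.2, by
      rw [Finset.card_sdiff_of_subset hu.2]; omega⟩ : s ⋖ u).exists_finset_insert
    exact ⟨a, by simpa using ha, hau⟩

theorem card_filter_card_eq_and_subset {j : ℕ} {s : Finset α} (hs : s.card = j + 1) :
    (Finset.univ.filter fun u : Finset α => u.card = j ∧ u ⊆ s).card = j + 1 := by
  have : (Finset.univ.filter fun u : Finset α => u.card = j ∧ u ⊆ s) = s.powersetCard j := by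
    ext u
    simp [Finset.mem_powersetCard, and_comm]
  rw [this, Finset.card_powersetCard, hs, Nat.choose_succ_self_right]

/-- Both counts are 1 if `s` and `t` differ by exchanging one element, the only candidates being `s
∪ t` and `s ∩ t`; otherwise the union is too large, the intersection too small, and both are 0. -/
theorem card_filter_union_subset_eq_card_filter_subset_inter {j : ℕ} {s t : Finset α}
    (hs : s.card = j + 1) (ht : t.card = j + 1) (hst : s ≠ t) :
    (Finset.univ.filter fun u : Finset α => u.card = j + 2 ∧ s ∪ t ⊆ u).card =
      (Finset.univ.filter fun u : Finset α => u.card = j ∧ u ⊆ s ∩ t).card := by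
  have hadd := Finset.card_union_add_card_inter s t
  have hlt : j + 1 < (s ∪ t).card := by
    by_contra hle
    have h1 : s = s ∪ t := Finset.eq_of_subset_of_card_le Finset.subset_union_left (by omega)
    have h2 : t = s ∪ t := Finset.eq_of_subset_of_card_le Finset.subset_union_right (by omega)
    exact hst (h1.trans h2.symm)
  by_cases hcard : (s ∪ t).card = j + 2
  · have h1 : (Finset.univ.filter fun u : Finset α => u.card = j + 2 ∧ s ∪ t ⊆ u) = {s ∪ t} := by
      ext u
      simp only [Finset.mem_filter, Finset.mem_univ, true_and, Finset.mem_singleton]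
      constructor
      · rintro ⟨hu, hsub⟩
        exact (Finset.eq_of_subset_of_card_le hsub (by omega)).symm
      · rintro rfl
        exact ⟨hcard, subset_rfl⟩
    have h2 : (Finset.univ.filter fun u : Finset α => u.card = j ∧ u ⊆ s ∩ t) = {s ∩ t} := by
      ext u
      simp only [Finset.mem_filter, Finset.mem_univ, true_and, Finset.mem_singleton]
      constructor
      · rintro ⟨hu, hsub⟩
        exact Finset.eq_of_subset_of_card_le hsub (by omega)
      · rintro rfl
        exact ⟨by omega, subset_rfl⟩
    rw [h1, h2, Finset.card_singleton, Finset.card_singleton]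
  · rw [Finset.card_eq_zero.mpr, Finset.card_eq_zero.mpr]
    · refine Finset.filter_eq_empty_iff.mpr fun u _ ⟨hu, hsub⟩ => ?_
      have := Finset.card_le_card hsub
      omega
    · refine Finset.filter_eq_empty_iff.mpr fun u _ ⟨hu, hsub⟩ => ?_
      have := Finset.card_le_card hsub
      omega

/-- The commutation relation between the up and down operators of the Boolean lattice. -/
theorem inclusionMatrix_succ_mul_transpose (j : ℕ) :
    inclusionMatrix α (j + 1) * (inclusionMatrix α (j + 1)).transpose =
      (inclusionMatrix α j).transpose * inclusionMatrix α j -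
        Matrix.scalar _ (2 * (j + 1) - (Fintype.card α : ℝ)) := by
  ext s t
  rw [inclusionMatrix_mul_transpose_apply, Matrix.sub_apply, transpose_mul_inclusionMatrix_apply]
  by_cases hst : s = t
  · subst hst
    have hs := card_filter_card_eq_succ_and_superset s.1
    have hle : j + 1 ≤ Fintype.card α := s.2 ▸ Finset.card_le_univ s.1
    rw [s.2] at hs
    rw [Finset.union_self, Finset.inter_self, hs, card_filter_card_eq_and_subset s.2,
      Nat.cast_sub hle, Matrix.scalar_apply, Matrix.diagonal_apply_eq]
    push_cast
    ring
  · rw [card_filter_union_subset_eq_card_filter_subset_inter s.2 t.2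
      (fun h => hst (Subtype.ext h)), Matrix.scalar_apply, Matrix.diagonal_apply_ne _ hst, sub_zero]

open Polynomial in
theorem charpoly_inclusionMatrix_mul_transpose (j : ℕ) (hj : j ≤ Fintype.card α / 2) :
    (inclusionMatrix α j * (inclusionMatrix α j).transpose).charpoly =
      ∏ i ∈ Finset.range (j + 1),
        (X - C (((j : ℝ) - i + 1) * ((Fintype.card α : ℝ) - i - j))) ^
          ((Fintype.card α).choose i - if i = 0 then 0 else (Fintype.card α).choose (i - 1)) := by
  induction j with
  | zero =>
    have h : inclusionMatrix α 0 * (inclusionMatrix α 0).transpose =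
        Matrix.diagonal fun _ => (Fintype.card α : ℝ) := by
      ext s t
      have hs : s.1 = ∅ := Finset.card_eq_zero.mp s.2
      have ht : t.1 = ∅ := Finset.card_eq_zero.mp t.2
      have hst : s = t := Subtype.ext (hs.trans ht.symm)
      have := card_filter_card_eq_succ_and_superset (∅ : Finset α)
      rw [Finset.card_empty] at this
      rw [inclusionMatrix_mul_transpose_apply, hs, ht, Finset.union_self, this, hst,
        Matrix.diagonal_apply_eq, Nat.sub_zero]
    rw [h, Matrix.charpoly_diagonal, Finset.prod_const, Finset.card_univ,
      Fintype.card_finset_len]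
    simp
  | succ j ih =>
    -- Below the middle level the extra power of `X` has a nonnegative exponent.
    have hchoose : (Fintype.card α).choose j ≤ (Fintype.card α).choose (j + 1) :=
      Nat.choose_le_succ_of_lt_half_left (by omega)
    rw [inclusionMatrix_succ_mul_transpose, Matrix.charpoly_sub_scalar,
      Matrix.charpoly_mul_comm_of_le _ _
        (by rwa [Fintype.card_finset_len, Fintype.card_finset_len]),
      ih (by omega), Fintype.card_finset_len, Fintype.card_finset_len,
      Finset.prod_range_succ _ (j + 1), mul_comm, Polynomial.mul_comp, Polynomial.prod_comp]
    -- With `a = j-i+1` and `b = n-i-j`, the shift takes the old root `a*b` to `(a+1)*(b-1)`; the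
    -- root 0 becomes `n-2(j+1)`, the factor `i = j+1`.
    congr 1
    · refine Finset.prod_congr rfl fun i _ => ?_
      rw [Polynomial.pow_comp, Polynomial.sub_comp, Polynomial.X_comp, Polynomial.C_comp,
        add_sub_assoc, ← C_sub, sub_eq_add_neg X, ← C_neg]
      congr 3
      push_cast
      ring_nf
    · rw [Polynomial.pow_comp, Polynomial.X_comp, if_neg (Nat.succ_ne_zero j), Nat.add_sub_cancel,
        sub_eq_add_neg X, ← C_neg]
      congr 3
      push_cast
      ring_nf

end inclusionMatrix

/-! ### Characteristic polynomial of the doubled odd graph -/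

theorem oddGraph_adjMatrix_eq_submatrix {k : ℕ} (hk : 2 ≤ k) :
    ∃ e : OddVertex k ≃ {s : Finset (Fin (2 * k - 1)) // s.card = k - 1 + 1},
      (oddGraph k).adjMatrix ℝ =
        (inclusionMatrix (Fin (2 * k - 1)) (k - 1)).submatrix (Equiv.refl _) e := by
  refine ⟨⟨fun v => ⟨v.1ᶜ, ?_⟩, fun w => ⟨w.1ᶜ, ?_⟩, fun v => ?_, fun w => ?_⟩, ?_⟩
  · rw [Finset.card_compl, v.2, Fintype.card_fin]; omega
  · rw [Finset.card_compl, w.2, Fintype.card_fin]; omega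
  · simp
  · simp
  · ext v w
    have hadj : (oddGraph k).Adj v w ↔ v.1 ⊆ w.1ᶜ := by
      rw [Finset.subset_compl_iff_disjoint_right]
      refine ⟨fun h => h.2, fun h => ⟨?_, h⟩⟩
      rintro rfl
      have h0 := v.2
      rw [Finset.disjoint_self_iff_empty] at h
      rw [h, Finset.card_empty] at h0
      omega
    simp [inclusionMatrix, SimpleGraph.adjMatrix_apply, hadj]

/-- As `A` is symmetric, its square is `A * Aᵀ`, in which the relabelling of columns by complements
cancels. -/
theorem oddGraph_adjMatrix_mul_self {k : ℕ} (hk : 2 ≤ k) :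
    (oddGraph k).adjMatrix ℝ * (oddGraph k).adjMatrix ℝ =
      inclusionMatrix (Fin (2 * k - 1)) (k - 1) *
        (inclusionMatrix (Fin (2 * k - 1)) (k - 1)).transpose := by
  obtain ⟨e, he⟩ := oddGraph_adjMatrix_eq_submatrix hk
  have hT : (oddGraph k).adjMatrix ℝ * (oddGraph k).adjMatrix ℝ =
      (oddGraph k).adjMatrix ℝ * ((oddGraph k).adjMatrix ℝ).transpose := by
    rw [SimpleGraph.transpose_adjMatrix]
  rw [hT, he, Matrix.transpose_submatrix, Matrix.submatrix_mul_equiv]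
  rfl

theorem doubledOddGraph_adjMatrix (k : ℕ) :
    (doubledOddGraph k).adjMatrix ℝ =
      Matrix.fromBlocks 0 ((oddGraph k).adjMatrix ℝ) ((oddGraph k).adjMatrix ℝ) 0 := by
  ext (v | v) (w | w) <;> simp [SimpleGraph.adjMatrix_apply]

open Polynomial in
theorem charpoly_doubledOddGraph_adjMatrix {k : ℕ} (hk : 2 ≤ k) :
    ((doubledOddGraph k).adjMatrix ℝ).charpoly =
      ∏ i ∈ Finset.range k,
        ((X - C ((k : ℝ) - i)) ^
            ((2 * k - 1).choose i - if i = 0 then 0 else (2 * k - 1).choose (i - 1)) *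
          (X - C (-((k : ℝ) - i))) ^
            ((2 * k - 1).choose i - if i = 0 then 0 else (2 * k - 1).choose (i - 1))) := by
  rw [doubledOddGraph_adjMatrix, charpoly_fromBlocks_zero_self, oddGraph_adjMatrix_mul_self hk,
    charpoly_inclusionMatrix_mul_transpose _ (by rw [Fintype.card_fin]; omega),
    Polynomial.prod_comp, Fintype.card_fin, Nat.sub_add_cancel (by omega : 1 ≤ k)]
  refine Finset.prod_congr rfl fun i _ => ?_
  rw [Polynomial.pow_comp, ← mul_pow, Polynomial.sub_comp, Polynomial.X_comp, Polynomial.C_comp]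
  congr 1
  rw [Nat.cast_sub (by omega : 1 ≤ 2 * k), Nat.cast_sub (by omega : 1 ≤ k)]
  have h : ((k : ℝ) - i) * (k - i) =
      (((k : ℝ) - (1 : ℕ)) - i + 1) * (((2 * k : ℕ) : ℝ) - (1 : ℕ) - i - (k - (1 : ℕ))) := by
    push_cast
    ring
  rw [← h, C_neg, C_mul]
  ring

/-! ### Multiplicities -/

open Polynomial in
theorem rootMultiplicity_prod_X_sub_C_mul_X_sub_C_neg {ι : Type*} {s : Finset ι} {y : ι → ℝ}
    (m : ι → ℕ) (hpos : ∀ i ∈ s, 0 < y i) (hinj : Set.InjOn y s) {i : ι} (hi : i ∈ s) {x : ℝ}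
    (hx : x = y i ∨ x = -y i) :
    (∏ i ∈ s, ((X - C (y i)) ^ m i * (X - C (-y i)) ^ m i)).rootMultiplicity x = m i := by
  classical
  have key : ∀ g : ℝ[X], g.eval x ≠ 0 → ((X - C x) ^ m i * g).rootMultiplicity x = m i := by
    intro g hg
    have hg0 : g ≠ 0 := by rintro rfl; simp at hg
    rw [rootMultiplicity_mul (mul_ne_zero (pow_ne_zero _ (X_sub_C_ne_zero x)) hg0),
      rootMultiplicity_X_sub_C_pow, rootMultiplicity_eq_zero hg, add_zero]
  -- Injectivity separates roots of equal sign, positivity those of opposite sign.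
  have hrest : (∏ j ∈ s.erase i, ((X - C (y j)) ^ m j * (X - C (-y j)) ^ m j)).eval x ≠ 0 := by
    rw [eval_prod, Finset.prod_ne_zero_iff]
    intro j hj
    have hjs := Finset.mem_of_mem_erase hj
    have hne : y i ≠ y j := fun h => Finset.ne_of_mem_erase hj (hinj hi hjs h).symm
    have h1 := hpos i hi
    have h2 := hpos j hjs
    simp only [eval_mul, eval_pow, eval_sub, eval_X, eval_C]
    refine mul_ne_zero (pow_ne_zero _ fun h => ?_) (pow_ne_zero _ fun h => ?_)
    · rcases hx with rfl | rfl
      · exact hne (by linarith)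
      · linarith
    · rcases hx with rfl | rfl
      · linarith
      · exact hne (by linarith)
  have h1 := hpos i hi
  rw [← Finset.mul_prod_erase _ _ hi]
  rcases hx with hx | hx
  · rw [← hx, mul_assoc]
    refine key _ ?_
    rw [eval_mul]
    refine mul_ne_zero ?_ hrest
    simp only [eval_pow, eval_sub, eval_X, eval_C]
    exact pow_ne_zero _ fun h => by linarith
  · rw [← hx, mul_comm ((X - C (y i)) ^ m i), mul_assoc]
    refine key _ ?_
    rw [eval_mul]
    refine mul_ne_zero ?_ hrest
    simp only [eval_pow, eval_sub, eval_X, eval_C]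
    exact pow_ne_zero _ fun h => by linarith

theorem rootMultiplicity_charpoly_doubledOddGraph_adjMatrix {k : ℕ} (hk : 2 ≤ k) {i : ℕ}
    (hi : i ≤ k - 1) {x : ℝ} (hx : x = (k : ℝ) - i ∨ x = -((k : ℝ) - i)) :
    ((doubledOddGraph k).adjMatrix ℝ).charpoly.rootMultiplicity x =
      (2 * k - 1).choose i - if i = 0 then 0 else (2 * k - 1).choose (i - 1) := by
  rw [charpoly_doubledOddGraph_adjMatrix hk]
  refine rootMultiplicity_prod_X_sub_C_mul_X_sub_C_neg (y := fun i : ℕ => (k : ℝ) - i)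
    (fun i => (2 * k - 1).choose i - if i = 0 then 0 else (2 * k - 1).choose (i - 1)) ?_ ?_
    (Finset.mem_range.mpr (by omega)) hx
  · intro j hj
    exact sub_pos.mpr (Nat.cast_lt.mpr (Finset.mem_range.mp hj))
  · intro a _ b _ h
    exact Nat.cast_injective (sub_right_injective h)

/-- Strictness makes each listed number an actual eigenvalue, and keeps the natural subtraction in
the exponents from truncating. -/
theorem ite_choose_pred_lt_choose {k i : ℕ} (hi : i ≤ k - 1) :
    (if i = 0 then 0 else (2 * k - 1).choose (i - 1)) < (2 * k - 1).choose i := by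
  rcases i with _ | i
  · simp
  · simp only [Nat.succ_ne_zero, if_false, Nat.add_sub_cancel]
    have hpos : 0 < (2 * k - 1).choose i := Nat.choose_pos (by omega)
    have h := Nat.choose_succ_right_eq (2 * k - 1) i
    by_contra! hle
    have h2 : (i + 1) < 2 * k - 1 - i := by omega
    have h3 := Nat.mul_lt_mul_of_pos_left h2 hpos
    have h4 := Nat.mul_le_mul_right (i + 1) hle
    omega

theorem proposition3 (k : ℕ) (hk : 2 ≤ k) :
    (∀ x : ℝ, Module.End.HasEigenvalue (Matrix.toLin' ((doubledOddGraph k).adjMatrix ℝ)) x ↔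
      ∃ i : ℕ, i ≤ k - 1 ∧ (x = (k : ℝ) - (i : ℝ) ∨ x = -((k : ℝ) - (i : ℝ)))) ∧
    ∀ i : ℕ, i ≤ k - 1 → ∀ x : ℝ, (x = (k : ℝ) - (i : ℝ) ∨ x = -((k : ℝ) - (i : ℝ))) →
      -- algebraic multiplicity
      (((((doubledOddGraph k).adjMatrix ℝ).charpoly.rootMultiplicity x : ℕ) : ℤ) =
        ((2 * k - 1).choose i : ℤ) - (if i = 0 then 0 else ((2 * k - 1).choose (i - 1) : ℤ))) ∧
      -- geometric multiplicity
      ((Module.finrank ℝ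
          (Module.End.eigenspace (Matrix.toLin' ((doubledOddGraph k).adjMatrix ℝ)) x) : ℤ) =
        ((2 * k - 1).choose i : ℤ) - (if i = 0 then 0 else ((2 * k - 1).choose (i - 1) : ℤ))) := by
  refine ⟨fun x => ?_, fun i hi x hx => ?_⟩
  · rw [Module.End.hasEigenvalue_iff_isRoot_charpoly, Matrix.charpoly_toLin']
    constructor
    · intro h
      rw [charpoly_doubledOddGraph_adjMatrix hk, Polynomial.IsRoot, Polynomial.eval_prod,
        Finset.prod_eq_zero_iff] at h
      obtain ⟨i, hi, h⟩ := h
      refine ⟨i, by have := Finset.mem_range.mp hi; omega, ?_⟩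
      simp only [Polynomial.eval_mul, Polynomial.eval_pow, Polynomial.eval_sub, Polynomial.eval_X,
        Polynomial.eval_C] at h
      rcases mul_eq_zero.mp h with h | h
      · exact Or.inl (sub_eq_zero.mp (eq_zero_of_pow_eq_zero h))
      · exact Or.inr (sub_eq_zero.mp (eq_zero_of_pow_eq_zero h))
    · rintro ⟨i, hi, hx⟩
      refine ((Polynomial.rootMultiplicity_pos (Matrix.charpoly_monic _).ne_zero).mp ?_)
      rw [rootMultiplicity_charpoly_doubledOddGraph_adjMatrix hk hi hx]
      exact Nat.sub_pos_of_lt (ite_choose_pred_lt_choose hi)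
  · rw [finrank_eigenspace_eq_rootMultiplicity_of_isSymm
      (SimpleGraph.isSymm_adjMatrix (doubledOddGraph k)), and_self,
      rootMultiplicity_charpoly_doubledOddGraph_adjMatrix hk hi hx,
      Nat.cast_sub (ite_choose_pred_lt_choose hi).le]
    split_ifs <;> simp
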